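/- A state on $\mathbb{C}^3$ is a positive semidefinite $3\times 3$ complex matrix of trace one; $\vec\lambda(\varrho)$ denotes its vector of eigenvalues with multiplicity. For $x,y\in\mathbb{R}^3$, $x\prec y$ ($x$ is majorised by $y$) means that for $k=1,2$ the sum of the $k$ largest entries of $x$ is at most the sum of the $k$ largest entries of $y$, and $\sum_i x_i=\sum_i y_i$. For an operator $X$ on $\mathbb{C}^3\otimes\mathbb{C}^3$, $\mathrm{Tr}_B X$ and $\mathrm{Tr}_A X$ denote the partial traces over the second and the first factor, respectively. Then the following hold. 1. For every pair of states $\varrho,\tilde\varrho$ on $\mathbb{C}^3$ with $\vec\lambda(\tilde\varrho)\prec\vec\lambda(\varrho)$ there exists a unitary $U_{AB}$ on $\mathbb{C}^3\otimes\mathbb{C}^3$ such that $$\mathrm{Tr}_B\bigl(U_{AB}(\varrho\otimes\varrho)U_{AB}^\dagger\bigr)=\tilde\varrho\quad\text{and}\quad \mathrm{Tr}_A\bigl(U_{AB}(\varrho\otimes\varrho)U_{AB}^\dagger\bigr)=\tilde\varrho .$$ 2. Consequently, symmetrically thermalizing unitaries exist for two qutrits: for every Hermitian $3\times3$ matrix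 $H$ and all inverse temperatures $0\le\beta'\le\beta<\infty$, with thermal states $\tau(\beta)=e^{-\beta H}/\mathrm{Tr}(e^{-\beta H})$, there exists a unitary $U_{AB}$ on $\mathbb{C}^3\otimes\mathbb{C}^3$ such that $$\mathrm{Tr}_B\bigl(U_{AB}(\tau(\beta)\otimes\tau(\beta))U_{AB}^\dagger\bigr)=\tau(\beta')\quad\text{and}\quad \mathrm{Tr}_A\bigl(U_{AB}(\tau(\beta)\otimes\tau(\beta))U_{AB}^\dagger\bigr)=\tau(\beta').$$ -/

import Mathlib

open scoped Matrix Kronecker ComplexOrder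

/-- A quantum state in dimension `n`, as a density matrix: positive semidefinite of trace one. -/
def IsDensityMatrix {n : ℕ} (ρ : Matrix (Fin n) (Fin n) ℂ) : Prop :=
  ρ.PosSemidef ∧ ρ.trace = 1

theorem IsDensityMatrix.isHermitian {n : ℕ} {ρ : Matrix (Fin n) (Fin n) ℂ}
    (h : IsDensityMatrix ρ) : ρ.IsHermitian :=
  h.1.isHermitian

/-- The vector of eigenvalues of a state, repeated according to multiplicity. -/
noncomputable def IsDensityMatrix.spectrumVec {n : ℕ} {ρ : Matrix (Fin n) (Fin n) ℂ}
    (h : IsDensityMatrix ρ) : Fin n → ℝ :=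
  h.isHermitian.eigenvalues

/-- The entries of `x`, rearranged in non-increasing order. -/
noncomputable def decreasingRearrangement {n : ℕ} (x : Fin n → ℝ) : Fin n → ℝ :=
  x ∘ Tuple.sort (fun i => -x i)

theorem decreasingRearrangement_antitone {n : ℕ} (x : Fin n → ℝ) :
    Antitone (decreasingRearrangement x) := fun _ _ hij =>
  neg_le_neg_iff.mp (Tuple.monotone_sort (fun i => -x i) hij)

/-- `x ≺ y` (`x` is majorised by `y`): for each `k`, the sum of the `k` largest entries of `x` is
at most the sum of the `k` largest entries of `y`, and the sums of all entries agree. -/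
def IsMajorisedBy {n : ℕ} (x y : Fin n → ℝ) : Prop :=
  (∀ k : ℕ, k ≤ n →
    ∑ i : Fin n with i.val < k, decreasingRearrangement x i ≤
      ∑ i : Fin n with i.val < k, decreasingRearrangement y i) ∧
  ∑ i, x i = ∑ i, y i

/-- The partial trace over the second factor `B`; its value is an operator on the first factor `A`. -/
def partialTraceB {n : ℕ} (M : Matrix (Fin n × Fin n) (Fin n × Fin n) ℂ) :
    Matrix (Fin n) (Fin n) ℂ :=
  Matrix.of fun i j => ∑ k, M (i, k) (j, k)

/-- The partial trace over the first factor `A`; its value is an operator on the second factor `B`. -/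
def partialTraceA {n : ℕ} (M : Matrix (Fin n × Fin n) (Fin n × Fin n) ℂ) :
    Matrix (Fin n) (Fin n) ℂ :=
  Matrix.of fun i j => ∑ k, M (k, i) (k, j)

/-- The thermal state `τ(β) = exp(-βH) / Tr(exp(-βH))` of the Hamiltonian `H`
at inverse temperature `β`. -/
noncomputable def thermalState {n : ℕ} (H : Matrix (Fin n) (Fin n) ℂ) (β : ℝ) :
    Matrix (Fin n) (Fin n) ℂ :=
  (Matrix.trace (NormedSpace.exp (-(β : ℂ) • H)))⁻¹ • NormedSpace.exp (-(β : ℂ) • H)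

/-- Both marginals of `U (ρ ⊗ ρ) U†` are equal to `σ`. -/
def HasSymmetricMarginals {n : ℕ} (U : Matrix (Fin n × Fin n) (Fin n × Fin n) ℂ)
    (ρ σ : Matrix (Fin n) (Fin n) ℂ) : Prop :=
  partialTraceB (U * (ρ ⊗ₖ ρ) * Uᴴ) = σ ∧ partialTraceA (U * (ρ ⊗ₖ ρ) * Uᴴ) = σ

/-- `U` is a symmetrically thermalizing unitary for two copies of a system with Hamiltonian `H`,
from inverse temperature `β` to inverse temperature `β'`. -/
def IsSTU {n : ℕ} (U : Matrix (Fin n × Fin n) (Fin n × Fin n) ℂ)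
    (H : Matrix (Fin n) (Fin n) ℂ) (β β' : ℝ) : Prop :=
  U ∈ Matrix.unitaryGroup (Fin n × Fin n) ℂ ∧
    HasSymmetricMarginals U (thermalState H β) (thermalState H β')

/-! Local unitaries reduce the problem to diagonal states with spectra `p` and `q`. In dimension
three, majorisation provides a unitary `V` with `q i = ∑ j, |V i j|² p j` (Horn). Split the nine
basis vectors into the orbits of the diagonal shift and let `V` act on each. Within an orbit both
coordinates are distinct, so the marginals stay diagonal. The orbit weights are `p j ^ 2` once and
`p (j+1) * p (j+2)` twice. Unit column sums turn the `i`-th marginal entry into `e₂ + ∑ j, |V i j|²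
(p j ^ 2 - p (j+1) * p (j+2))`, with `e₂` the second elementary symmetric polynomial of `p`. Since
`∑ p = 1`, the bracket is `p j - e₂`, and the unit row sum leaves `q i`. For thermal states, heating
lowers the ground population and raises the top one, which is all that Horn's theorem needs here. -/

/-! ### Horn's theorem in dimension three -/

/-- `q` is the diagonal of a matrix unitarily conjugate to `diagonal p`. -/
def IsUnistochasticImage (q p : Fin 3 → ℝ) : Prop :=
  ∃ V ∈ Matrix.unitaryGroup (Fin 3) ℂ, ∀ i, (q i : ℂ) = ∑ j, V i j * p j * star (V i j)

theorem IsUnistochasticImage.of_perm {q p : Fin 3 → ℝ} (s t : Equiv.Perm (Fin 3))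
    (h : IsUnistochasticImage (q ∘ s) (p ∘ t)) : IsUnistochasticImage q p := by
  obtain ⟨V, hV, h⟩ := h
  refine ⟨V.submatrix s.symm t.symm, ?_, fun i => ?_⟩
  · rw [Matrix.mem_unitaryGroup_iff] at hV ⊢
    rw [Matrix.star_eq_conjTranspose] at hV ⊢
    rw [Matrix.conjTranspose_submatrix, Matrix.submatrix_mul_equiv, hV,
      Matrix.submatrix_one_equiv]
  · have := h (s.symm i)
    simp only [Function.comp_apply, Equiv.apply_symm_apply] at this
    rw [this, ← Equiv.sum_comp t.symm]
    simp

/-- Two plane rotations realise two successive T-transforms. -/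
theorem isUnistochasticImage_of_convexCombination {q p : Fin 3 → ℝ} {t u : ℝ}
    (ht : t ∈ Set.Icc (0 : ℝ) 1) (hu : u ∈ Set.Icc (0 : ℝ) 1)
    (h0 : q 0 = t * p 0 + (1 - t) * p 1)
    (h1 : q 1 = u * (p 0 + p 1 - q 0) + (1 - u) * p 2)
    (hsum : q 0 + q 1 + q 2 = p 0 + p 1 + p 2) : IsUnistochasticImage q p := by
  obtain ⟨c, hc⟩ : ∃ c, c = √t := ⟨_, rfl⟩
  obtain ⟨s, hs⟩ : ∃ s, s = √(1 - t) := ⟨_, rfl⟩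
  obtain ⟨d, hd⟩ : ∃ d, d = √u := ⟨_, rfl⟩
  obtain ⟨r, hr⟩ : ∃ r, r = √(1 - u) := ⟨_, rfl⟩
  have hc2 : c ^ 2 = t := by rw [hc, Real.sq_sqrt ht.1]
  have hs2 : s ^ 2 = 1 - t := by rw [hs, Real.sq_sqrt (by linarith [ht.2])]
  have hd2 : d ^ 2 = u := by rw [hd, Real.sq_sqrt hu.1]
  have hr2 : r ^ 2 = 1 - u := by rw [hr, Real.sq_sqrt (by linarith [hu.2])]
  have hcs : (c : ℂ) ^ 2 + (s : ℂ) ^ 2 = 1 := by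
    rw [← Complex.ofReal_pow, ← Complex.ofReal_pow, hc2, hs2]; push_cast; ring
  have hdr : (d : ℂ) ^ 2 + (r : ℂ) ^ 2 = 1 := by
    rw [← Complex.ofReal_pow, ← Complex.ofReal_pow, hd2, hr2]; push_cast; ring
  -- A rotation in the plane of coordinates 0, 1, followed by one in the plane of 1, 2.
  refine ⟨!![(c : ℂ), s, 0; -(d * s), d * c, r; r * s, -(r * c), d], ?_, fun i => ?_⟩
  · rw [Matrix.mem_unitaryGroup_iff]
    ext i j
    fin_cases i <;> fin_cases j <;>
      simp [Matrix.mul_apply, Fin.sum_univ_three, Matrix.star_apply] <;>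
      grind
  · have hq1 : q 1 = d ^ 2 * (s ^ 2 * p 0 + c ^ 2 * p 1) + r ^ 2 * p 2 := by
      rw [h1, h0, hc2, hs2, hd2, hr2]; ring
    have hq2 : q 2 = r ^ 2 * (s ^ 2 * p 0 + c ^ 2 * p 1) + d ^ 2 * p 2 := by
      have : q 2 = p 0 + p 1 + p 2 - q 0 - q 1 := by linarith
      rw [this, h1, h0, hc2, hs2, hd2, hr2]; ring
    have hq0 : q 0 = c ^ 2 * p 0 + s ^ 2 * p 1 := by rw [h0, hc2, hs2]
    fin_cases i <;> simp [Fin.sum_univ_three, hq0, hq1, hq2] <;> ring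

theorem exists_convexCombination_of_le {a b x : ℝ} (hax : a ≤ x) (hxb : x ≤ b) :
    ∃ t ∈ Set.Icc (0 : ℝ) 1, x = t * a + (1 - t) * b := by
  obtain ⟨t, u, ht, hu, htu, h⟩ := (segment_eq_Icc (hax.trans hxb)).ge ⟨hax, hxb⟩
  refine ⟨t, ⟨ht, by linarith⟩, ?_⟩
  rw [← h, ← htu]
  simp

theorem exists_convexCombination_of_ge {a b x : ℝ} (hax : x ≤ a) (hxb : b ≤ x) :
    ∃ t ∈ Set.Icc (0 : ℝ) 1, x = t * a + (1 - t) * b := by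
  obtain ⟨t, ht, h⟩ := exists_convexCombination_of_le hxb hax
  exact ⟨1 - t, ⟨by linarith [ht.2], by linarith [ht.1]⟩, by linarith⟩

/-- Horn's theorem in dimension three, for vectors in non-increasing order. -/
theorem isUnistochasticImage_of_antitone {q p : Fin 3 → ℝ} (hq : Antitone q)
    (h0 : q 0 ≤ p 0) (h2 : p 2 ≤ q 2) (hsum : ∑ i, q i = ∑ i, p i) :
    IsUnistochasticImage q p := by
  rw [Fin.sum_univ_three, Fin.sum_univ_three] at hsum
  have hq01 : q 1 ≤ q 0 := hq (by decide)
  have hq12 : q 2 ≤ q 1 := hq (by decide)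
  rcases le_total (p 1) (q 0) with h | h
  -- Mix `p 0` and `p 1` to produce `q 0`, then mix the remainder with `p 2`; it is at least `q 1`
  -- exactly because `p 2 ≤ q 2`.
  · obtain ⟨t, ht, ht'⟩ := exists_convexCombination_of_ge h0 h
    obtain ⟨u, hu, hu'⟩ := exists_convexCombination_of_ge
      (a := p 0 + p 1 - q 0) (b := p 2) (x := q 1) (by linarith) (by linarith)
    exact isUnistochasticImage_of_convexCombination ht hu ht' hu' hsum
  -- Now `q 0` may lie outside the interval between `p 1` and `p 0`, so the same construction starts
  -- from the bottom, with indices reversed.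
  · obtain ⟨t, ht, ht'⟩ := exists_convexCombination_of_le h2 (hq12.trans (hq01.trans h))
    obtain ⟨u, hu, hu'⟩ := exists_convexCombination_of_le
      (a := p 2 + p 1 - q 2) (b := p 0) (x := q 1) (by linarith) (by linarith)
    refine IsUnistochasticImage.of_perm Fin.revPerm Fin.revPerm
      (isUnistochasticImage_of_convexCombination ht hu ht' hu' ?_)
    change q 2 + q 1 + q 0 = p 2 + p 1 + p 0
    linarith

theorem IsMajorisedBy.isUnistochasticImage {q p : Fin 3 → ℝ} (h : IsMajorisedBy q p) :
    IsUnistochasticImage q p := by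
  obtain ⟨h, hsum⟩ := h
  have hsum' : ∑ i, decreasingRearrangement q i = ∑ i, decreasingRearrangement p i := by
    simp only [decreasingRearrangement, Function.comp_apply]
    rw [Equiv.sum_comp _ q, Equiv.sum_comp _ p, hsum]
  have h1 := h 1 (by norm_num)
  have h2 := h 2 (by norm_num)
  simp only [Finset.sum_filter, Fin.sum_univ_three] at h1 h2 hsum'
  norm_num at h1 h2
  -- The bound for the two largest entries, subtracted from the equal totals.
  have h3 : decreasingRearrangement p 2 ≤ decreasingRearrangement q 2 := by linarith
  exact IsUnistochasticImage.of_perm _ _ (isUnistochasticImage_of_antitone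
    (decreasingRearrangement_antitone q) h1 h3 (by rwa [Fin.sum_univ_three, Fin.sum_univ_three]))

/-! ### Cyclic blocks and their marginals -/

/-- The basis vectors `(i, k)` of the `k`-th cyclic block: `(i, i)`, `(i + 1, i + 2)`,
`(i + 2, i + 1)`. -/
def cyclicBlockEquiv : Fin 3 × Fin 3 ≃ Fin 3 × Fin 3 where
  toFun x := (x.1 + x.2, x.1 + 2 * x.2)
  invFun y := (2 * y.1 - y.2, y.2 - y.1)
  left_inv := by decide
  right_inv := by decide

/-- `V` acting simultaneously on the three cyclic blocks. -/
def cyclicBlockUnitary (V : Matrix (Fin 3) (Fin 3) ℂ) :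
    Matrix (Fin 3 × Fin 3) (Fin 3 × Fin 3) ℂ :=
  (V ⊗ₖ (1 : Matrix (Fin 3) (Fin 3) ℂ)).submatrix cyclicBlockEquiv.symm cyclicBlockEquiv.symm

theorem cyclicBlockUnitary_mem {V : Matrix (Fin 3) (Fin 3) ℂ}
    (hV : V ∈ Matrix.unitaryGroup (Fin 3) ℂ) :
    cyclicBlockUnitary V ∈ Matrix.unitaryGroup (Fin 3 × Fin 3) ℂ := by
  have h := Matrix.kronecker_mem_unitary hV (one_mem (Matrix.unitaryGroup (Fin 3) ℂ))
  rw [Matrix.mem_unitaryGroup_iff, Matrix.star_eq_conjTranspose] at h ⊢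
  rw [cyclicBlockUnitary, Matrix.conjTranspose_submatrix, Matrix.submatrix_mul_equiv, h,
    Matrix.submatrix_one_equiv]

/-- The difference of coordinates labels the block and `2 * x.1 - x.2` the position inside it; the
conjugated matrix is block diagonal. -/
theorem cyclicBlockUnitary_conj_apply (V : Matrix (Fin 3) (Fin 3) ℂ) (p : Fin 3 → ℂ)
    (x y : Fin 3 × Fin 3) :
    (cyclicBlockUnitary V * (Matrix.diagonal p ⊗ₖ Matrix.diagonal p) * (cyclicBlockUnitary V)ᴴ) x y =
      if x.2 - x.1 = y.2 - y.1 then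
        ∑ j, V (2 * x.1 - x.2) j * (p (j + (x.2 - x.1)) * p (j + 2 * (x.2 - x.1))) *
          star (V (2 * y.1 - y.2) j)
      else 0 := by
  rw [Matrix.diagonal_kronecker_diagonal, Matrix.mul_apply, ← Equiv.sum_comp cyclicBlockEquiv,
    Fintype.sum_prod_type_right]
  simp only [Matrix.mul_diagonal, Matrix.conjTranspose_apply, cyclicBlockUnitary,
    Matrix.submatrix_apply, Equiv.symm_apply_apply, Matrix.kroneckerMap_apply, Matrix.one_apply,
    mul_ite, mul_one, mul_zero, ite_mul, zero_mul, apply_ite star, star_zero,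
    Finset.sum_ite_irrel, Finset.sum_const_zero, Finset.sum_ite_eq, Finset.mem_univ, if_true]
  have hφ (j k : Fin 3) : cyclicBlockEquiv (j, k) = (j + k, j + 2 * k) := rfl
  have hψ (z : Fin 3 × Fin 3) : cyclicBlockEquiv.symm z = (2 * z.1 - z.2, z.2 - z.1) := rfl
  simp only [hφ, hψ]
  split_ifs with h1
  · rw [h1]
  · rfl

theorem hasSymmetricMarginals_cyclicBlockUnitary {V : Matrix (Fin 3) (Fin 3) ℂ}
    (hV : V ∈ Matrix.unitaryGroup (Fin 3) ℂ) {q p : Fin 3 → ℝ}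
    (hp : ∑ i, p i = 1) (hq : ∀ i, (q i : ℂ) = ∑ j, V i j * p j * star (V i j)) :
    HasSymmetricMarginals (cyclicBlockUnitary V) (Matrix.diagonal fun i => (p i : ℂ))
      (Matrix.diagonal fun i => (q i : ℂ)) := by
  have hp' : (p 0 : ℂ) + p 1 + p 2 = 1 := by
    rw [Fin.sum_univ_three] at hp; exact_mod_cast hp
  have hrow (i : Fin 3) : ∑ j, V i j * star (V i j) = 1 := by
    have := congrFun₂ (Matrix.mem_unitaryGroup_iff.1 hV) i i
    simpa [Matrix.mul_apply, Matrix.star_apply] using this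
  have hcol (j : Fin 3) : ∑ i, V i j * star (V i j) = 1 := by
    have := congrFun₂ (Matrix.mem_unitaryGroup_iff'.1 hV) j j
    simpa [Matrix.mul_apply, Matrix.star_apply, mul_comm] using this
  -- Here `k` is the row of `V` and `i - k` the block; `k = i` gives the squares `p j ^ 2`.
  have hdiag (i : Fin 3) :
      ∑ k, ∑ j, V k j * ((p (j + (i - k)) : ℂ) * p (j + (k - i))) * star (V k j) = q i := by
    have hr := hrow i
    have h0 := hcol 0
    have h1 := hcol 1
    have h2 := hcol 2
    have h := hq i
    simp only [Fin.sum_univ_three] at hr h0 h1 h2 h ⊢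
    have e1 : (-1 : Fin 3) = 2 := rfl
    have e2 : (-2 : Fin 3) = 1 := rfl
    have e3 : (2 : Fin 3) + 1 = 0 := rfl
    have e4 : (2 : Fin 3) + 2 = 1 := rfl
    have e5 : (1 : Fin 3) + 1 = 2 := rfl
    have e6 : (1 : Fin 3) + 2 = 0 := rfl
    generalize (q i : ℂ) = x at h ⊢
    fin_cases i <;>
    · simp [sub_eq_add_neg, e1, e2, e3, e4, e5, e6] at hr h0 h1 h2 h ⊢
      -- Column sums absorb the rows other than `i`, the row sum cancels `e₂`, and `hp'` normalises
      -- `p 0 + p 1 + p 2`.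
      linear_combination (p 1 * p 2 : ℂ) * h0 + (p 2 * p 0 : ℂ) * h1 + (p 0 * p 1 : ℂ) * h2
        - (p 0 + p 1 + p 2 : ℂ) * h - (p 1 * p 2 + p 2 * p 0 + p 0 * p 1 : ℂ) * hr + x * hp'
  constructor
  · ext i j
    rw [partialTraceB, Matrix.of_apply]
    -- With one coordinate shared, two vectors lie in the same block only if they coincide.
    simp only [cyclicBlockUnitary_conj_apply, sub_right_inj, Matrix.diagonal_apply]
    split_ifs with h
    · subst h
      rw [← hdiag, ← Equiv.sum_comp (Equiv.subLeft (2 * i))]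
      refine Finset.sum_congr rfl fun k _ => Finset.sum_congr rfl fun j _ => ?_
      have e0 : ∀ i k : Fin 3, 2 * i - (2 * i - k) = k := by decide
      have e1 : ∀ i k j : Fin 3, j + (2 * i - k - i) = j + (i - k) := by decide
      have e2 : ∀ i k j : Fin 3, j + 2 * (2 * i - k - i) = j + (k - i) := by decide
      rw [Equiv.subLeft_apply, e0, e1, e2]
    · exact Finset.sum_const_zero
  · ext i j
    rw [partialTraceA, Matrix.of_apply]
    simp only [cyclicBlockUnitary_conj_apply, sub_left_inj, Matrix.diagonal_apply]
    split_ifs with h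
    · subst h
      -- The row of `V` is `2 * k - i`; modulo 3, substituting `-i - k` for `k` turns it into `k`.
      rw [← hdiag, ← Equiv.sum_comp (Equiv.subLeft (-i))]
      refine Finset.sum_congr rfl fun k _ => Finset.sum_congr rfl fun j _ => ?_
      have e0 : ∀ i k : Fin 3, 2 * (-i - k) - i = k := by decide
      have e1 : ∀ i k j : Fin 3, j + (i - (-i - k)) = j + (k - i) := by decide
      have e2 : ∀ i k j : Fin 3, j + 2 * (i - (-i - k)) = j + (i - k) := by decide
      rw [Equiv.subLeft_apply, e0, e1, e2, mul_comm (p (j + (i - k)) : ℂ)]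
    · exact Finset.sum_const_zero

/-! ### Local unitaries and partial traces -/

theorem kronecker_conj_apply {n : ℕ} (V W : Matrix (Fin n) (Fin n) ℂ)
    (M : Matrix (Fin n × Fin n) (Fin n × Fin n) ℂ) (x y : Fin n × Fin n) :
    ((V ⊗ₖ W) * M * (V ⊗ₖ W)ᴴ) x y =
      ∑ b, ∑ a, V x.1 a.1 * M a b * star (V y.1 b.1) * (star (W y.2 b.2) * W x.2 a.2) := by
  simp only [Matrix.mul_apply, Matrix.conjTranspose_apply, Matrix.kroneckerMap_apply, star_mul',
    Finset.sum_mul]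
  exact Finset.sum_congr rfl fun b _ => Finset.sum_congr rfl fun a _ => by ring

theorem sum_star_mul_of_mem_unitaryGroup {n : ℕ} {W : Matrix (Fin n) (Fin n) ℂ}
    (hW : W ∈ Matrix.unitaryGroup (Fin n) ℂ) (a b : Fin n) :
    ∑ k, star (W k b) * W k a = if b = a then 1 else 0 := by
  rw [← Matrix.one_apply, ← Matrix.mem_unitaryGroup_iff'.1 hW]
  rfl

/-- Column orthonormality of `W` makes the traced-out factor disappear. -/
theorem partialTraceB_kronecker_conj {n : ℕ} {V W : Matrix (Fin n) (Fin n) ℂ}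
    (hW : W ∈ Matrix.unitaryGroup (Fin n) ℂ) (M : Matrix (Fin n × Fin n) (Fin n × Fin n) ℂ) :
    partialTraceB ((V ⊗ₖ W) * M * (V ⊗ₖ W)ᴴ) = V * partialTraceB M * Vᴴ := by
  ext i j
  simp only [partialTraceB, Matrix.of_apply, kronecker_conj_apply]
  rw [Finset.sum_comm]
  simp_rw [Finset.sum_comm (s := Finset.univ (α := Fin n)) (t := Finset.univ (α := Fin n × Fin n)),
    ← Finset.mul_sum, sum_star_mul_of_mem_unitaryGroup hW, Fintype.sum_prod_type]
  simp only [mul_ite, mul_one, mul_zero, Finset.sum_ite_eq, Finset.mem_univ, if_true,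
    Matrix.mul_apply, Matrix.of_apply, Matrix.conjTranspose_apply, Finset.mul_sum, Finset.sum_mul]
  exact Finset.sum_congr rfl fun b _ => Finset.sum_comm

theorem partialTraceA_kronecker_conj {n : ℕ} {V W : Matrix (Fin n) (Fin n) ℂ}
    (hV : V ∈ Matrix.unitaryGroup (Fin n) ℂ) (M : Matrix (Fin n × Fin n) (Fin n × Fin n) ℂ) :
    partialTraceA ((V ⊗ₖ W) * M * (V ⊗ₖ W)ᴴ) = W * partialTraceA M * Wᴴ := by
  have h : partialTraceA ((V ⊗ₖ W) * M * (V ⊗ₖ W)ᴴ) =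
      partialTraceB ((W ⊗ₖ V) * M.submatrix Prod.swap Prod.swap * (W ⊗ₖ V)ᴴ) := by
    ext i j
    simp only [partialTraceA, partialTraceB, Matrix.of_apply, kronecker_conj_apply]
    refine Finset.sum_congr rfl fun k _ => ?_
    rw [← Equiv.sum_comp (Equiv.prodComm _ _)]
    refine Finset.sum_congr rfl fun b _ => ?_
    rw [← Equiv.sum_comp (Equiv.prodComm _ _)]
    refine Finset.sum_congr rfl fun a _ => ?_
    simp only [Equiv.prodComm_apply, Prod.fst_swap, Prod.snd_swap, Matrix.submatrix_apply]
    ring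
  rw [h, partialTraceB_kronecker_conj hV]
  rfl

/-- Rotate into the eigenbasis of `ρ`, act on the blocks, rotate out to that of `σ`. -/
theorem IsUnistochasticImage.exists_hasSymmetricMarginals {q p : Fin 3 → ℝ}
    (h : IsUnistochasticImage q p) (hp : ∑ i, p i = 1) {W X ρ σ : Matrix (Fin 3) (Fin 3) ℂ}
    (hW : W ∈ Matrix.unitaryGroup (Fin 3) ℂ) (hX : X ∈ Matrix.unitaryGroup (Fin 3) ℂ)
    (hρ : ρ = W * Matrix.diagonal (fun i => (p i : ℂ)) * Wᴴ)
    (hσ : σ = X * Matrix.diagonal (fun i => (q i : ℂ)) * Xᴴ) :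
    ∃ U ∈ Matrix.unitaryGroup (Fin 3 × Fin 3) ℂ, HasSymmetricMarginals U ρ σ := by
  obtain ⟨V, hV, hVq⟩ := h
  obtain ⟨hB, hA⟩ := hasSymmetricMarginals_cyclicBlockUnitary hV hp hVq
  have hWW := Matrix.kronecker_mem_unitary hW hW
  have hWW' := Matrix.mem_unitaryGroup_iff'.1 hWW
  rw [Matrix.star_eq_conjTranspose] at hWW'
  refine ⟨(X ⊗ₖ X) * cyclicBlockUnitary V * (W ⊗ₖ W)ᴴ,
    mul_mem (mul_mem (Matrix.kronecker_mem_unitary hX hX) (cyclicBlockUnitary_mem hV))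
      (Unitary.star_mem hWW), ?_⟩
  have key : (X ⊗ₖ X) * cyclicBlockUnitary V * (W ⊗ₖ W)ᴴ * (ρ ⊗ₖ ρ) *
      ((X ⊗ₖ X) * cyclicBlockUnitary V * (W ⊗ₖ W)ᴴ)ᴴ =
      (X ⊗ₖ X) * (cyclicBlockUnitary V * (Matrix.diagonal (fun i => (p i : ℂ)) ⊗ₖ
        Matrix.diagonal (fun i => (p i : ℂ))) * (cyclicBlockUnitary V)ᴴ) * (X ⊗ₖ X)ᴴ := by
    have hρρ : ρ ⊗ₖ ρ = (W ⊗ₖ W) * (Matrix.diagonal (fun i => (p i : ℂ)) ⊗ₖ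
        Matrix.diagonal (fun i => (p i : ℂ))) * (W ⊗ₖ W)ᴴ := by
      rw [hρ, Matrix.conjTranspose_kronecker, ← Matrix.mul_kronecker_mul,
        ← Matrix.mul_kronecker_mul]
    rw [hρρ]
    simp only [Matrix.conjTranspose_mul, Matrix.conjTranspose_conjTranspose]
    generalize Matrix.diagonal (fun i => (p i : ℂ)) ⊗ₖ Matrix.diagonal (fun i => (p i : ℂ)) = D
    generalize W ⊗ₖ W = Y at hWW' ⊢
    have cancel (Z : Matrix (Fin 3 × Fin 3) (Fin 3 × Fin 3) ℂ) : Yᴴ * (Y * Z) = Z := by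
      rw [← Matrix.mul_assoc, hWW', Matrix.one_mul]
    simp only [Matrix.mul_assoc, cancel]
  constructor
  · rw [key, partialTraceB_kronecker_conj hX, hB, hσ]
  · rw [key, partialTraceA_kronecker_conj hX, hA, hσ]

theorem Matrix.IsHermitian.eq_conj_diagonal {n : ℕ} {H : Matrix (Fin n) (Fin n) ℂ}
    (hH : H.IsHermitian) :
    H = (hH.eigenvectorUnitary : Matrix (Fin n) (Fin n) ℂ) *
      Matrix.diagonal (fun i => (hH.eigenvalues i : ℂ)) *
      (hH.eigenvectorUnitary : Matrix (Fin n) (Fin n) ℂ)ᴴ := by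
  exact hH.spectral_theorem

theorem IsDensityMatrix.sum_spectrumVec {n : ℕ} {ρ : Matrix (Fin n) (Fin n) ℂ}
    (h : IsDensityMatrix ρ) : ∑ i, h.spectrumVec i = 1 := by
  have := h.isHermitian.trace_eq_sum_eigenvalues
  rw [h.2] at this
  change ∑ i, h.isHermitian.eigenvalues i = 1
  rw [← Complex.ofReal_inj]
  push_cast
  exact this.symm

/-! ### Thermal states -/

/-- The Boltzmann distribution of the energies `h` at inverse temperature `β`. -/
noncomputable def boltzmann {n : ℕ} (h : Fin n → ℝ) (β : ℝ) (i : Fin n) : ℝ :=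
  (∑ j, Real.exp (-β * h j))⁻¹ * Real.exp (-β * h i)

/-- In this form monotonicity in `β` is visible at the extreme levels, where all the gaps `h i - h
j` have one sign. -/
theorem boltzmann_eq_inv_sum {n : ℕ} (h : Fin n → ℝ) (β : ℝ) (i : Fin n) :
    boltzmann h β i = (∑ j, Real.exp (β * (h i - h j)))⁻¹ := by
  rw [boltzmann, ← inv_inv (Real.exp (-β * h i)), ← mul_inv, ← Real.exp_neg, Finset.sum_mul]
  congr 1
  refine Finset.sum_congr rfl fun j _ => ?_
  rw [← Real.exp_add]
  ring_nf

theorem sum_boltzmann {n : ℕ} [NeZero n] (h : Fin n → ℝ) (β : ℝ) : ∑ i, boltzmann h β i = 1 := by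
  have : 0 < ∑ j, Real.exp (-β * h j) := Finset.sum_pos (fun _ _ => Real.exp_pos _) ⟨0, by simp⟩
  simp only [boltzmann, ← Finset.mul_sum]
  exact inv_mul_cancel₀ this.ne'

theorem boltzmann_comp_perm {n : ℕ} (h : Fin n → ℝ) (β : ℝ) (s : Equiv.Perm (Fin n)) :
    boltzmann (h ∘ s) β = boltzmann h β ∘ s := by
  funext i
  simp only [boltzmann, Function.comp_apply]
  rw [Equiv.sum_comp s fun j => Real.exp (-β * h j)]

theorem boltzmann_antitone {n : ℕ} {h : Fin n → ℝ} (hh : Monotone h) {β : ℝ} (hβ : 0 ≤ β) :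
    Antitone (boltzmann h β) := fun i j hij => by
  have := hh hij
  have h0 : 0 ≤ (∑ j, Real.exp (-β * h j))⁻¹ :=
    inv_nonneg.2 (Finset.sum_nonneg fun _ _ => (Real.exp_pos _).le)
  refine mul_le_mul_of_nonneg_left (Real.exp_le_exp.2 ?_) h0
  nlinarith

theorem inv_sum_exp_le_inv_sum_exp {n : ℕ} [NeZero n] {f g : Fin n → ℝ} (hfg : ∀ i, f i ≤ g i) :
    (∑ i, Real.exp (g i))⁻¹ ≤ (∑ i, Real.exp (f i))⁻¹ :=
  inv_anti₀ (Finset.sum_pos (fun _ _ => Real.exp_pos _) ⟨0, by simp⟩)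
    (Finset.sum_le_sum fun i _ => Real.exp_le_exp.2 (hfg i))

/-- Heating a thermal distribution is a unistochastic transformation. -/
theorem isUnistochasticImage_boltzmann (h : Fin 3 → ℝ) {β β' : ℝ} (hβ' : 0 ≤ β') (hβ : β' ≤ β) :
    IsUnistochasticImage (boltzmann h β') (boltzmann h β) := by
  have hm : Monotone (h ∘ Tuple.sort h) := Tuple.monotone_sort h
  refine IsUnistochasticImage.of_perm (Tuple.sort h) (Tuple.sort h) ?_
  rw [← boltzmann_comp_perm, ← boltzmann_comp_perm]
  generalize h ∘ Tuple.sort h = f at hm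
  refine isUnistochasticImage_of_antitone (boltzmann_antitone hm hβ') ?_ ?_ ?_
  · rw [boltzmann_eq_inv_sum, boltzmann_eq_inv_sum]
    refine inv_sum_exp_le_inv_sum_exp fun j => ?_
    have : f 0 ≤ f j := hm (Fin.zero_le j)
    nlinarith
  · rw [boltzmann_eq_inv_sum, boltzmann_eq_inv_sum]
    refine inv_sum_exp_le_inv_sum_exp fun j => ?_
    have : f j ≤ f 2 := hm (Fin.le_last j)
    nlinarith
  · rw [sum_boltzmann, sum_boltzmann]

theorem thermalState_eq_conj_diagonal {n : ℕ} {H : Matrix (Fin n) (Fin n) ℂ}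
    (hH : H.IsHermitian) (β : ℝ) :
    thermalState H β = (hH.eigenvectorUnitary : Matrix (Fin n) (Fin n) ℂ) *
      Matrix.diagonal (fun i => (boltzmann hH.eigenvalues β i : ℂ)) *
      (hH.eigenvectorUnitary : Matrix (Fin n) (Fin n) ℂ)ᴴ := by
  have hW := hH.eigenvectorUnitary.2
  have hd := hH.eq_conj_diagonal
  generalize (hH.eigenvectorUnitary : Matrix (Fin n) (Fin n) ℂ) = W at hW hd ⊢
  generalize hH.eigenvalues = h at hd ⊢
  have h1 : W * Wᴴ = 1 := Matrix.mem_unitaryGroup_iff.1 hW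
  have h2 : Wᴴ * W = 1 := Matrix.mem_unitaryGroup_iff'.1 hW
  have hinv : W⁻¹ = Wᴴ := Matrix.inv_eq_right_inv h1
  have hexp : NormedSpace.exp (-(β : ℂ) • H) =
      W * Matrix.diagonal (fun i => ((Real.exp (-β * h i) : ℝ) : ℂ)) * Wᴴ := by
    have : -(β : ℂ) • H = W * Matrix.diagonal (fun i => ((-β * h i : ℝ) : ℂ)) * W⁻¹ := by
      rw [hinv, hd, ← Matrix.smul_mul, ← Matrix.mul_smul, ← Matrix.diagonal_smul]
      congr 3
      funext i
      simp
    rw [this, Matrix.exp_conj _ _ (IsUnit.of_mul_eq_one _ h1), Matrix.exp_diagonal, hinv]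
    congr 3
    funext i
    rw [Pi.coe_exp, ← Complex.exp_eq_exp_ℂ, Complex.ofReal_exp]
  rw [thermalState, hexp, Matrix.trace_mul_cycle, h2, Matrix.one_mul, Matrix.trace_diagonal,
    ← Matrix.smul_mul, ← Matrix.mul_smul, ← Matrix.diagonal_smul]
  congr 3
  funext i
  simp [boltzmann]

theorem mainTheorem1 :
    (∀ (ρ σ : Matrix (Fin 3) (Fin 3) ℂ) (hρ : IsDensityMatrix ρ) (hσ : IsDensityMatrix σ),
      IsMajorisedBy hσ.spectrumVec hρ.spectrumVec →
      ∃ U ∈ Matrix.unitaryGroup (Fin 3 × Fin 3) ℂ, HasSymmetricMarginals U ρ σ) ∧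
    (∀ (H : Matrix (Fin 3) (Fin 3) ℂ), H.IsHermitian →
      ∀ β β' : ℝ, 0 ≤ β' → β' ≤ β → ∃ U, IsSTU U H β β') := by
  refine ⟨fun ρ σ hρ hσ h => ?_, fun H hH β β' hβ' hβ => ?_⟩
  · exact h.isUnistochasticImage.exists_hasSymmetricMarginals hρ.sum_spectrumVec
      hρ.isHermitian.eigenvectorUnitary.2 hσ.isHermitian.eigenvectorUnitary.2
      hρ.isHermitian.eq_conj_diagonal hσ.isHermitian.eq_conj_diagonal
  · exact (isUnistochasticImage_boltzmann hH.eigenvalues hβ' hβ).exists_hasSymmetricMarginals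
      (sum_boltzmann _ _) hH.eigenvectorUnitary.2 hH.eigenvectorUnitary.2
      (thermalState_eq_conj_diagonal hH β) (thermalState_eq_conj_diagonal hH β')
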